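/- Let $\mathbb{K}$ be an algebraically closed field of characteristic zero and let $t \ge 2$ be an integer. Let $G_t$ be the graph on the vertices $x_1,x_2,y_1,\dots,y_t,z_1,z_2,w_1,w_2$ with the $2t+6$ edges $$a_i=\{x_1,y_i\},\quad b_i=\{x_2,y_i\}\quad (1\le i\le t),$$ $$e_1=\{x_1,z_1\},\ e_2=\{z_1,z_2\},\ e_3=\{z_2,x_1\},\quad f_1=\{x_2,w_1\},\ f_2=\{w_1,w_2\},\ f_3=\{w_2,x_2\}.$$ Let $\mathbb{K}[E_t]$ be the polynomial ring whose variables are these edges, and let $I_{G_t}\subseteq \mathbb{K}[E_t]$ be the toric ideal of $G_t$, i.e. the kernel of the $\mathbb{K}$-algebra homomorphism from $\mathbb{K}[E_t]$ to the polynomial ring in the vertices that sends each edge $\{u,v\}$ to $uv$. Let $\mathrm{in}(I_{G_t})$ be its initial ideal with respect to the graded reverse lexicographic order with $$a_1>\dots>a_t>f_1>f_2>f_3>e_1>e_2>e_3>b_1>\dots>b_t.$$ Put $$\mathcal M_1=\{a_ib_j \mid 1\le j<i\le t\},\quad \mathcal M_2=\{a_ia_jf_1f_3e_2\mid 1\le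 i<j\le t\},\quad \mathcal M_3=\{a_i^2f_1f_3e_2\mid 1\le i\le t\},$$ and list the elements of each of these sets from smallest to largest in this monomial order: \begin{align*} &\mathcal M_1:\ a_tb_{t-1},\ a_tb_{t-2},\ a_{t-1}b_{t-2},\ \dots,\ a_2b_1 &&(\text{by decreasing } j, \text{ then decreasing } i),\\ &\mathcal M_2:\ a_ta_{t-1}f_1f_3e_2,\ a_ta_{t-2}f_1f_3e_2,\ \dots,\ a_2a_1f_1f_3e_2 &&(\text{with larger index first, lexicographically decreasing}),\\ &\mathcal M_3:\ a_t^2f_1f_3e_2,\ a_{t-1}^2f_1f_3e_2,\ \dots,\ a_1^2f_1f_3e_2. \end{align*} Let $g_1,\dots,g_m$ be the concatenation of these three lists, in this order. Then $m=t^2$, the monomials $g_1,\dots,g_{t^2}$ are a minimal system of generators of $\mathrm{in}(I_{G_t})$, and $\mathrm{in}(I_{G_t})$ has linear quotients with respect to this order of the generators: for every $2\le p\le t^2$ the colon ideal $\langle g_1,\dots,g_{p-1}\rangle:\langle g_p\rangle$ is generated by variables. Furthermore, if $n_p$ denotes the number of different variables generating $\langle g_1,\dots,g_{p-1}\rangle:\langle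 g_p\rangle$, then $$\max\{n_p \mid 2\le p\le t^2\}=2t-2.$$ -/

import Mathlib

open MvPolynomial
open scoped MonomialOrder

/-! ### The graded reverse lexicographic order -/

/-- Type synonym carrying the graded reverse lexicographic order on exponent vectors. -/
def DegRevLex (σ : Type*) : Type _ := σ →₀ ℕ

namespace DegRevLex

variable {σ : Type*}

/-- The identity map to the synonym. -/
def mk : (σ →₀ ℕ) ≃ DegRevLex σ := Equiv.refl _

/-- The identity map from the synonym. -/
def get : DegRevLex σ ≃ (σ →₀ ℕ) := Equiv.refl _

noncomputable instance : AddCommMonoid (DegRevLex σ) := get.addCommMonoid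

theorem mk_add (u v : σ →₀ ℕ) : mk (u + v) = mk u + mk v := rfl

theorem get_add (u v : DegRevLex σ) : get (u + v) = get u + get v := rfl

/-- The sort key: the total degree first, then the reversed colexicographic order. -/
noncomputable def key (u : DegRevLex σ) : ℕ ×ₗ (Colex (σ →₀ ℕ))ᵒᵈ :=
  toLex ((get u).degree, OrderDual.toDual (toColex (get u)))

theorem key_injective : Function.Injective (key (σ := σ)) := by
  intro u v h
  exact get.injective (toColex.injective (OrderDual.toDual.injective
    (congrArg (fun p => (ofLex p).2) h)))

variable [LinearOrder σ]

noncomputable instance : LinearOrder (DegRevLex σ) :=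
  LinearOrder.lift' key key_injective

theorem lt_iff {u v : DegRevLex σ} : u < v ↔ (get u).degree < (get v).degree ∨
    ((get u).degree = (get v).degree ∧ toColex (get v) < toColex (get u)) := by
  change key u < key v ↔ _
  simp [key, Prod.Lex.toLex_lt_toLex]

theorem le_iff {u v : DegRevLex σ} : u ≤ v ↔ (get u).degree < (get v).degree ∨
    ((get u).degree = (get v).degree ∧ toColex (get v) ≤ toColex (get u)) := by
  change key u ≤ key v ↔ _
  simp [key, Prod.Lex.toLex_le_toLex]

theorem mk_monotone : Monotone (mk (σ := σ)) := by
  intro u v h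
  rcases eq_or_ne u v with rfl | hne
  · exact le_rfl
  · refine le_iff.2 (Or.inl ?_)
    change u.degree < v.degree
    obtain ⟨w, rfl⟩ := exists_add_of_le h
    have hw : w ≠ 0 := by
      rintro rfl
      simp at hne
    have h1 : w.degree ≠ 0 := by
      simpa [Finsupp.degree_eq_zero_iff] using hw
    rw [map_add]
    omega

instance : IsOrderedAddMonoid (DegRevLex σ) where
  add_le_add_left u v h w := by
    rw [le_iff] at h ⊢
    rw [get_add, get_add, map_add, map_add, toColex_add, toColex_add]
    rcases h with h | ⟨h1, h2⟩
    · exact Or.inl (Nat.add_lt_add_right h _)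
    · exact Or.inr ⟨congrArg (· + _) h1, add_le_add_left h2 _⟩

instance [Finite σ] : WellFoundedLT (DegRevLex σ) := by
  refine ⟨?_⟩
  rw [RelEmbedding.wellFounded_iff_isEmpty]
  refine ⟨fun f => ?_⟩
  obtain ⟨m, n, hmn, hle⟩ :=
    wellQuasiOrdered_le (α := σ →₀ ℕ) (fun n => get (f n))
  exact absurd (f.map_rel_iff.2 hmn) (not_lt.2 (mk_monotone hle))

end DegRevLex

/-- The graded reverse lexicographic monomial order. The variables are ordered by
`X i > X j` if and only if `i < j`. -/
noncomputable def degRevLex (σ : Type*) [LinearOrder σ] [Finite σ] : MonomialOrder σ where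
  syn := DegRevLex σ
  toSyn := { toEquiv := DegRevLex.mk, map_add' := DegRevLex.mk_add }
  toSyn_monotone := DegRevLex.mk_monotone

/-- Explicit form: `u < v` iff `u` has smaller degree, or the degrees agree and, at the last
variable (the smallest one) at which the exponents differ, `u` has the larger exponent. -/
theorem degRevLex_lt_iff {σ : Type*} [LinearOrder σ] [Finite σ] {u v : σ →₀ ℕ} :
    u ≺[degRevLex σ] v ↔ u.degree < v.degree ∨
      (u.degree = v.degree ∧ ∃ i, (∀ j, i < j → u j = v j) ∧ v i < u i) := by
  refine (DegRevLex.lt_iff (u := DegRevLex.mk u) (v := DegRevLex.mk v)).trans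
    (or_congr Iff.rfl (and_congr Iff.rfl
      (Finsupp.Colex.lt_iff.trans (exists_congr fun i => and_congr ?_ Iff.rfl))))
  exact forall_congr' fun j => imp_congr Iff.rfl eq_comm

/-! ### Initial ideals, linear quotients -/

/-- The initial ideal of `I`: the ideal generated by the leading terms of its elements. -/
noncomputable def initialIdeal {σ K : Type*} [CommSemiring K] (m : MonomialOrder σ)
    (I : Ideal (MvPolynomial σ K)) : Ideal (MvPolynomial σ K) :=
  Ideal.span (m.leadingTerm '' (I : Set (MvPolynomial σ K)))

/-- The ideal of `K[σ]` generated by the monomials with exponent vectors in `s`. -/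
noncomputable def monomialIdeal (K : Type*) {σ : Type*} [CommSemiring K] (s : Set (σ →₀ ℕ)) :
    Ideal (MvPolynomial σ K) :=
  Ideal.span ((fun u => monomial u (1 : K)) '' s)

/-- The list `g` of monomials is a minimal system of generators of the ideal `I`: it generates
`I`, and no entry lies in the ideal generated by the entries at the other positions. -/
def IsMinimalMonomialGenerators {σ K : Type*} [CommSemiring K] (I : Ideal (MvPolynomial σ K))
    (g : List (σ →₀ ℕ)) : Prop :=
  monomialIdeal K {u | u ∈ g} = I ∧
    ∀ p : Fin g.length,
      monomial (g.get p) (1 : K) ∉ monomialIdeal K {u | ∃ q : Fin g.length, q ≠ p ∧ u = g.get q}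

/-- For a list `g = [g₁, …, gₘ]` of monomials and the (zero-based) position `p`, the ideal
`⟨g₁, …, gₚ⟩ : ⟨gₚ₊₁⟩`: all entries before the given position, colon the entry there. -/
noncomputable def colonAt (K : Type*) {σ : Type*} [CommRing K] (g : List (σ →₀ ℕ))
    (p : Fin g.length) : Ideal (MvPolynomial σ K) :=
  (monomialIdeal K {u | u ∈ g.take p}).colon
    (Ideal.span {monomial (g.get p) (1 : K)} : Ideal (MvPolynomial σ K))

/-- `I` has linear quotients with respect to the ordering `g` of its minimal monomial generators:
every successive colon ideal (from the second generator on) is generated by variables. -/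
def HasLinearQuotientsWith {σ K : Type*} [CommRing K] (I : Ideal (MvPolynomial σ K))
    (g : List (σ →₀ ℕ)) : Prop :=
  IsMinimalMonomialGenerators I g ∧
    ∀ p : Fin g.length, 1 ≤ (p : ℕ) →
      ∃ S : Set σ, colonAt K g p = Ideal.span ((fun i => (X i : MvPolynomial σ K)) '' S)

/-- The number of different variables in the colon ideal at position `p`; if this ideal is
generated by a set of variables, it is the number of these variables. -/
noncomputable def numColonVars (K : Type*) {σ : Type*} [CommRing K] (g : List (σ →₀ ℕ))
    (p : Fin g.length) : ℕ :=
  {i : σ | (X i : MvPolynomial σ K) ∈ colonAt K g p}.ncard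

theorem numColonVars_eq {K σ : Type*} [CommRing K] [Nontrivial K] (g : List (σ →₀ ℕ))
    (p : Fin g.length) (S : Set σ)
    (h : colonAt K g p = Ideal.span ((fun i => (X i : MvPolynomial σ K)) '' S)) :
    numColonVars K g p = S.ncard := by
  have hS : {i : σ | (X i : MvPolynomial σ K) ∈ colonAt K g p} = S := by
    classical
    ext i
    rw [Set.mem_ofPred_eq, h, mem_ideal_span_X_image]
    simp [support_X, Finsupp.single_apply]
  rw [numColonVars, hS]

/-! ### Toric ideals of graphs -/

/-- The toric ideal of a graph `G`: the kernel of the `K`-algebra map `K[E] → K[V]` sending the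
variable of an edge `{u, v}` to the product of the variables `u` and `v`. -/
noncomputable def SimpleGraph.toricIdeal (K : Type*) [CommRing K] {V : Type*}
    (G : SimpleGraph V) : Ideal (MvPolynomial G.edgeSet K) :=
  RingHom.ker (aeval (R := K)
    (fun e : G.edgeSet => (Sym2.map (X : V → MvPolynomial V K) (e : Sym2 V)).mul))

/-! ### The graph `G_t` -/

namespace TriangleGraph

/-- The vertices of `G_t`; `y i` for `i : Fin t` is the vertex `y_{i+1}`. -/
inductive Vertex (t : ℕ) : Type
  | x₁ : Vertex t
  | x₂ : Vertex t
  | y : Fin t → Vertex t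
  | z₁ : Vertex t
  | z₂ : Vertex t
  | w₁ : Vertex t
  | w₂ : Vertex t

open Vertex in
/-- `K_{2,t}` on `{x₁, x₂}` and the `y i`, with a triangle attached at each of `x₁` and `x₂`. -/
def graph (t : ℕ) : SimpleGraph (Vertex t) :=
  SimpleGraph.fromEdgeSet
    (Set.range (fun j : Fin t => s(x₁, y j)) ∪ Set.range (fun j : Fin t => s(x₂, y j)) ∪
      {s(x₁, z₁), s(z₁, z₂), s(z₂, x₁)} ∪ {s(x₂, w₁), s(w₁, w₂), s(w₂, x₂)})

/-- The labels of the edges of `G_t`, used as the variables of `K[E_t]`. The indices of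
`a` and `b` are shifted by one: `i : Fin t` stands for `i + 1`. -/
inductive EdgeVar (t : ℕ) : Type
  | a : Fin t → EdgeVar t
  | f₁ : EdgeVar t
  | f₂ : EdgeVar t
  | f₃ : EdgeVar t
  | e₁ : EdgeVar t
  | e₂ : EdgeVar t
  | e₃ : EdgeVar t
  | b : Fin t → EdgeVar t

namespace EdgeVar

/-- The position of a variable in the list
`a₁ > ⋯ > a_t > f₁ > f₂ > f₃ > e₁ > e₂ > e₃ > b₁ > ⋯ > b_t`. -/
def pos {t : ℕ} : EdgeVar t → ℕ
  | a i => i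
  | f₁ => t
  | f₂ => t + 1
  | f₃ => t + 2
  | e₁ => t + 3
  | e₂ => t + 4
  | e₃ => t + 5
  | b i => t + 6 + i

theorem pos_injective {t : ℕ} : Function.Injective (pos (t := t)) := by
  intro u v h
  cases u <;> cases v <;> simp only [pos, a.injEq, b.injEq, reduceCtorEq, Fin.ext_iff] at h ⊢ <;>
    omega

/-- Variables are ordered by position; an earlier position means a larger variable in the
monomial order. -/
instance (t : ℕ) : LinearOrder (EdgeVar t) := LinearOrder.lift' pos pos_injective

instance (t : ℕ) : Finite (EdgeVar t) := by
  refine Finite.of_injective (β := Fin (2 * t + 6))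
    (fun u => ⟨u.pos, by cases u <;> simp only [pos] <;> omega⟩) ?_
  intro u v h
  exact pos_injective (congrArg Fin.val h)

/-- The pair of vertices joined by the edge with the given label. -/
def ends {t : ℕ} : EdgeVar t → Sym2 (Vertex t)
  | a i => s(Vertex.x₁, Vertex.y i)
  | f₁ => s(Vertex.x₂, Vertex.w₁)
  | f₂ => s(Vertex.w₁, Vertex.w₂)
  | f₃ => s(Vertex.w₂, Vertex.x₂)
  | e₁ => s(Vertex.x₁, Vertex.z₁)
  | e₂ => s(Vertex.z₁, Vertex.z₂)
  | e₃ => s(Vertex.z₂, Vertex.x₁)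
  | b i => s(Vertex.x₂, Vertex.y i)

theorem ends_mem {t : ℕ} (u : EdgeVar t) : u.ends ∈ (graph t).edgeSet := by
  cases u <;> simp [ends, graph]

/-- The edge with the given label. -/
def edge {t : ℕ} (u : EdgeVar t) : (graph t).edgeSet := ⟨u.ends, u.ends_mem⟩

theorem edge_bijective (t : ℕ) : Function.Bijective (edge (t := t)) := by
  constructor
  · intro u v h
    have h' : u.ends = v.ends := congrArg Subtype.val h
    cases u <;> cases v <;> simp_all [ends]
  · rintro ⟨s, hs⟩
    have hs' := hs
    simp only [graph, SimpleGraph.edgeSet_fromEdgeSet, Set.mem_sdiff, Set.mem_union,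
      Set.mem_range, Set.mem_insert_iff, Set.mem_singleton_iff] at hs'
    rcases hs'.1 with ((⟨j, rfl⟩ | ⟨j, rfl⟩) | rfl | rfl | rfl) | rfl | rfl | rfl
    exacts [⟨a j, rfl⟩, ⟨b j, rfl⟩, ⟨e₁, rfl⟩, ⟨e₂, rfl⟩, ⟨e₃, rfl⟩, ⟨f₁, rfl⟩, ⟨f₂, rfl⟩,
      ⟨f₃, rfl⟩]

end EdgeVar

/-- The toric ideal of `G_t` in `K[a₁, …, a_t, f₁, f₂, f₃, e₁, e₂, e₃, b₁, …, b_t]`: the toric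
ideal of the graph, transported along the bijective labelling of the edges. -/
noncomputable def toricIdeal (K : Type*) [CommRing K] (t : ℕ) :
    Ideal (MvPolynomial (EdgeVar t) K) :=
  ((graph t).toricIdeal K).comap (rename (R := K) (EdgeVar.edge (t := t)))

/-- The exponent vector of a single variable. -/
noncomputable abbrev var {t : ℕ} (u : EdgeVar t) : EdgeVar t →₀ ℕ := Finsupp.single u 1

/-- The monomial `a_i b_j`. -/
noncomputable def quadric {t : ℕ} (i j : Fin t) : EdgeVar t →₀ ℕ :=
  var (.a i) + var (.b j)

/-- The monomial `a_i a_j f₁ f₃ e₂`. -/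
noncomputable def quintic {t : ℕ} (i j : Fin t) : EdgeVar t →₀ ℕ :=
  var (.a i) + var (.a j) + var .f₁ + var .f₃ + var .e₂

/-- `{a_i b_j | 1 ≤ j < i ≤ t}`. -/
def M₁ (t : ℕ) : Set (EdgeVar t →₀ ℕ) := {u | ∃ i j : Fin t, j < i ∧ u = quadric i j}

/-- `{a_i a_j f₁ f₃ e₂ | 1 ≤ i < j ≤ t}`. -/
def M₂ (t : ℕ) : Set (EdgeVar t →₀ ℕ) := {u | ∃ i j : Fin t, i < j ∧ u = quintic i j}

/-- `{a_i² f₁ f₃ e₂ | 1 ≤ i ≤ t}`. -/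
def M₃ (t : ℕ) : Set (EdgeVar t →₀ ℕ) := {u | ∃ i : Fin t, u = quintic i i}

/-- `[t, t - 1, …, 1]`, as elements of `Fin t`. -/
def descending (t : ℕ) : List (Fin t) := (List.finRange t).reverse

/-- `a_t b_{t-1}, a_t b_{t-2}, a_{t-1} b_{t-2}, …, a_2 b_1`, by decreasing `j`, then by
decreasing `i`. -/
noncomputable def L₁ (t : ℕ) : List (EdgeVar t →₀ ℕ) :=
  (descending t).flatMap fun j =>
    ((descending t).filter (fun i => j < i)).map fun i => quadric i j

/-- `a_t a_{t-1} f₁ f₃ e₂, a_t a_{t-2} f₁ f₃ e₂, …, a_2 a_1 f₁ f₃ e₂`. -/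
noncomputable def L₂ (t : ℕ) : List (EdgeVar t →₀ ℕ) :=
  (descending t).flatMap fun i =>
    ((descending t).filter (fun j => j < i)).map fun j => quintic i j

/-- `a_t² f₁ f₃ e₂, a_{t-1}² f₁ f₃ e₂, …, a_1² f₁ f₃ e₂`. -/
noncomputable def L₃ (t : ℕ) : List (EdgeVar t →₀ ℕ) :=
  (descending t).map fun i => quintic i i

/-- The ordered list `g_1, …, g_{t²}` of generators. -/
noncomputable def generators (t : ℕ) : List (EdgeVar t →₀ ℕ) := L₁ t ++ L₂ t ++ L₃ t

/-- The list `l` enumerates the set `M` of monomials from smallest to largest, without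
repetition, in the graded reverse lexicographic order. -/
def IsIncreasingEnumeration {t : ℕ} (l : List (EdgeVar t →₀ ℕ)) (M : Set (EdgeVar t →₀ ℕ)) :
    Prop :=
  {u | u ∈ l} = M ∧ l.Pairwise (fun u v => u ≺[degRevLex (EdgeVar t)] v)

end TriangleGraph

/-! ### Monomial ideals and their colon ideals -/

section MonomialIdeal

variable {σ K : Type*}

/-! The toric ideal is homogeneous for the grading by vertex degrees, so the leading monomial `u` of
a nonzero element shares its vertex degrees with a smaller monomial `v`. Comparing the exponents of
`u` and `v` directly shows that some monomial of `M₁`, `M₂` or `M₃` divides `u` (`exists_le_of_lt`).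
Conversely each of these is the leading term of a binomial of an even closed walk: a 4-cycle for
`M₁`, a walk through both triangles for `M₂` and `M₃`. This gives `initialIdeal_eq`, without
Buchberger's criterion.

Colon ideals of monomial ideals are a matter of divisibility. It suffices that for each generator
`u` earlier than `v` there is a variable `e` in the colon ideal whose exponent is larger in `u` than
in `v` (`colonAt_eq_span_X`). In `exists_variable` such an `e` is found by replacing one factor of
`v` by a factor of `u` so that the result is again an earlier generator. To speak of "earlier"
without positions, the list is shown to be sorted by the relation `Before`.

For the count, let `i` be the larger `a`-index of `v`. The colon ideal at `v` can contain neither `a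
i`, nor the last `b`, nor any triangle edge; this leaves at most `2 * t - 2` variables. All of them
occur at the square quintic with the last index. -/

theorem mem_monomialIdeal_iff [CommSemiring K] {s : Set (σ →₀ ℕ)} {h : MvPolynomial σ K} :
    h ∈ monomialIdeal K s ↔ ∀ v ∈ h.support, ∃ u ∈ s, u ≤ v :=
  mem_ideal_span_monomial_image

theorem monomial_mem_monomialIdeal_iff [CommSemiring K] [Nontrivial K] {s : Set (σ →₀ ℕ)}
    {v : σ →₀ ℕ} : monomial v (1 : K) ∈ monomialIdeal K s ↔ ∃ u ∈ s, u ≤ v := by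
  classical
  rw [mem_monomialIdeal_iff, support_monomial, if_neg one_ne_zero]
  simp

variable [CommRing K] {g : List (σ →₀ ℕ)} {p : Fin g.length}

theorem mem_colonAt_iff {h : MvPolynomial σ K} :
    h ∈ colonAt K g p ↔ ∀ v ∈ h.support, ∃ u ∈ g.take p, u ≤ v + g.get p := by
  rw [colonAt, Ideal.mem_colon_span_singleton, mem_monomialIdeal_iff]
  constructor
  · intro H v hv
    refine H (v + g.get p) ?_
    rw [mem_support_iff, coeff_mul_monomial, mul_one]
    exact mem_support_iff.1 hv
  · intro H w hw
    rw [mem_support_iff, coeff_mul_monomial'] at hw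
    split_ifs at hw with hle
    · rw [mul_one] at hw
      obtain ⟨u, hu, huv⟩ := H _ (mem_support_iff.2 hw)
      exact ⟨u, hu, huv.trans_eq (tsub_add_cancel_of_le hle)⟩
    · exact absurd rfl hw

theorem X_mem_colonAt_iff [Nontrivial K] {i : σ} :
    (X i : MvPolynomial σ K) ∈ colonAt K g p ↔
      ∃ u ∈ g.take p, u ≤ Finsupp.single i 1 + g.get p := by
  rw [mem_colonAt_iff, support_X]
  simp

/-- A colon ideal of monomial ideals is generated by the variables in it as soon as every earlier
generator exceeds the current one in one of these variables. -/
theorem colonAt_eq_span_X [Nontrivial K]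
    (H : ∀ u ∈ g.take p, ∃ i, (∃ s ∈ g.take p, s ≤ Finsupp.single i 1 + g.get p) ∧
      g.get p i < u i) :
    colonAt K g p = Ideal.span ((fun i => (X i : MvPolynomial σ K)) ''
      {i | (X i : MvPolynomial σ K) ∈ colonAt K g p}) := by
  apply le_antisymm
  · intro h hh
    refine mem_ideal_span_X_image.2 fun v hv => ?_
    obtain ⟨u, hu, huv⟩ := mem_colonAt_iff.1 hh v hv
    obtain ⟨i, hi, hlt⟩ := H u hu
    -- Since `u` divides `v + g.get p` but exceeds `g.get p` at `i`, the variable `i` must divide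
    -- `v`.
    refine ⟨i, X_mem_colonAt_iff.2 hi, ?_⟩
    have := huv i
    rw [Finsupp.add_apply] at this
    omega
  · rw [Ideal.span_le]
    rintro _ ⟨i, hi, rfl⟩
    exact hi

end MonomialIdeal

/-- In a list sorted by an asymmetric relation, coming earlier is the relation itself; this removes
positions from the study of the colon ideals. -/
theorem List.mem_take_iff_of_pairwise {α : Type*} {r : α → α → Prop} (hr : ∀ a b, r a b → ¬ r b a)
    {l : List α} (hl : l.Pairwise r) (p : Fin l.length) {u : α} :
    u ∈ l.take p ↔ u ∈ l ∧ r u (l.get p) := by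
  rw [List.pairwise_iff_get] at hl
  rw [List.mem_take_iff_getElem]
  constructor
  · rintro ⟨i, hi, rfl⟩
    refine ⟨List.getElem_mem _, hl ⟨i, by omega⟩ p ?_⟩
    rw [Fin.lt_def]; simp only; omega
  · rintro ⟨hu, h⟩
    obtain ⟨i, rfl⟩ := List.get_of_mem hu
    have : i < p := by
      rcases lt_trichotomy i p with h1 | rfl | h1
      · exact h1
      · exact absurd h (hr _ _ h)
      · exact absurd h (hr _ _ (hl _ _ h1))
    exact ⟨i, by rw [Fin.lt_def] at this; omega, rfl⟩

namespace TriangleGraph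

open EdgeVar

variable {t : ℕ}

/-! ### Degrees of vertices -/

/-- The degree of the monomial map of the graph: the exponents of the vertices in the image
of a monomial in the edges. -/
noncomputable def vertexDegree (t : ℕ) : (EdgeVar t →₀ ℕ) →ₗ[ℕ] (Vertex t →₀ ℕ) :=
  Finsupp.linearCombination ℕ fun e : EdgeVar t =>
    Sym2.lift ⟨fun u v => Finsupp.single u 1 + Finsupp.single v 1, fun _ _ => add_comm _ _⟩ e.ends

theorem aeval_edge_monomial (K : Type*) [CommRing K] (u : EdgeVar t →₀ ℕ) (c : K) :
    aeval (R := K) (fun e : EdgeVar t =>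
      (Sym2.map (X : Vertex t → MvPolynomial (Vertex t) K) e.ends).mul) (monomial u c) =
      monomial (vertexDegree t u) c := by
  have h (e : EdgeVar t) : (Sym2.map (X : Vertex t → MvPolynomial (Vertex t) K) e.ends).mul =
      monomial (vertexDegree t (Finsupp.single e 1)) 1 := by
    rw [vertexDegree, Finsupp.linearCombination_single, one_smul]
    induction e.ends with
    | _ v w => simp [X, monomial_mul]
  simp only [h, aeval_monomial, monomial_pow, one_pow]
  rw [algebraMap_eq, Finsupp.prod, ← monomial_sum_index]
  simp [vertexDegree, Finsupp.linearCombination_apply, Finsupp.sum]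

theorem mem_toricIdeal_iff (K : Type*) [CommRing K] {h : MvPolynomial (EdgeVar t) K} :
    h ∈ toricIdeal K t ↔ aeval (R := K) (fun e : EdgeVar t =>
      (Sym2.map (X : Vertex t → MvPolynomial (Vertex t) K) e.ends).mul) h = 0 := by
  rw [toricIdeal, Ideal.mem_comap, SimpleGraph.toricIdeal, RingHom.mem_ker]
  exact Eq.congr_left (aeval_rename _ _ _)

theorem monomial_sub_monomial_mem_toricIdeal (K : Type*) [CommRing K] {u v : EdgeVar t →₀ ℕ}
    (h : vertexDegree t u = vertexDegree t v) :
    monomial u (1 : K) - monomial v 1 ∈ toricIdeal K t := by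
  rw [mem_toricIdeal_iff, map_sub, aeval_edge_monomial, aeval_edge_monomial, h, sub_self]

/-- A monomial of an element of the toric ideal is accompanied by another one with the same
vertex degrees. -/
theorem exists_mem_support_of_mem_toricIdeal {K : Type*} [CommRing K]
    {h : MvPolynomial (EdgeVar t) K} (hh : h ∈ toricIdeal K t) {u : EdgeVar t →₀ ℕ}
    (hu : u ∈ h.support) : ∃ v ∈ h.support, v ≠ u ∧ vertexDegree t v = vertexDegree t u := by
  classical
  by_contra! H
  rw [mem_toricIdeal_iff, h.as_sum, map_sum] at hh
  have h1 := congrArg (coeff (vertexDegree t u)) hh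
  rw [coeff_sum, Finset.sum_eq_single u] at h1
  · rw [aeval_edge_monomial, coeff_monomial, if_pos rfl, coeff_zero] at h1
    exact mem_support_iff.1 hu h1
  · intro v hv hvu
    rw [aeval_edge_monomial, coeff_monomial, if_neg (H v hv hvu)]
  · exact fun h => absurd hu h

theorem vertexDegree_x₁ (u : EdgeVar t →₀ ℕ) :
    vertexDegree t u .x₁ = ∑ i, u (a i) + u e₁ + u e₃ := by
  induction u using Finsupp.induction_linear with
  | zero => simp
  | add u v hu hv => simp only [map_add, Finsupp.add_apply, hu, hv, Finset.sum_add_distrib]; ring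
  | single e k => cases e <;> simp [vertexDegree, ends, Finsupp.single_apply]

theorem vertexDegree_x₂ (u : EdgeVar t →₀ ℕ) :
    vertexDegree t u .x₂ = ∑ i, u (b i) + u f₁ + u f₃ := by
  induction u using Finsupp.induction_linear with
  | zero => simp
  | add u v hu hv => simp only [map_add, Finsupp.add_apply, hu, hv, Finset.sum_add_distrib]; ring
  | single e k => cases e <;> simp [vertexDegree, ends, Finsupp.single_apply]

theorem vertexDegree_y (u : EdgeVar t →₀ ℕ) (i : Fin t) :
    vertexDegree t u (.y i) = u (a i) + u (b i) := by
  classical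
  induction u using Finsupp.induction_linear with
  | zero => simp
  | add u v hu hv => simp only [map_add, Finsupp.add_apply, hu, hv]; ring
  | single e k => cases e <;> simp [vertexDegree, ends, Finsupp.single_apply]

theorem vertexDegree_z₁ (u : EdgeVar t →₀ ℕ) : vertexDegree t u .z₁ = u e₁ + u e₂ := by
  induction u using Finsupp.induction_linear with
  | zero => simp
  | add u v hu hv => simp only [map_add, Finsupp.add_apply, hu, hv]; ring
  | single e k => cases e <;> simp [vertexDegree, ends]

theorem vertexDegree_z₂ (u : EdgeVar t →₀ ℕ) : vertexDegree t u .z₂ = u e₂ + u e₃ := by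
  induction u using Finsupp.induction_linear with
  | zero => simp
  | add u v hu hv => simp only [map_add, Finsupp.add_apply, hu, hv]; ring
  | single e k => cases e <;> simp [vertexDegree, ends]

theorem vertexDegree_w₁ (u : EdgeVar t →₀ ℕ) : vertexDegree t u .w₁ = u f₁ + u f₂ := by
  induction u using Finsupp.induction_linear with
  | zero => simp
  | add u v hu hv => simp only [map_add, Finsupp.add_apply, hu, hv]; ring
  | single e k => cases e <;> simp [vertexDegree, ends]

theorem vertexDegree_w₂ (u : EdgeVar t →₀ ℕ) : vertexDegree t u .w₂ = u f₂ + u f₃ := by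
  induction u using Finsupp.induction_linear with
  | zero => simp
  | add u v hu hv => simp only [map_add, Finsupp.add_apply, hu, hv]; ring
  | single e k => cases e <;> simp [vertexDegree, ends]

theorem degree_eq (u : EdgeVar t →₀ ℕ) : u.degree =
    ∑ i, u (a i) + ∑ i, u (b i) + u f₁ + u f₂ + u f₃ + u e₁ + u e₂ + u e₃ := by
  induction u using Finsupp.induction_linear with
  | zero => simp
  | add u v hu hv => simp only [map_add, Finsupp.add_apply, hu, hv, Finset.sum_add_distrib]; ring
  | single e k => cases e <;> simp [Finsupp.single_apply]

/-! ### The initial ideal -/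

theorem quintic_comm (i j : Fin t) : quintic i j = quintic j i := by
  simp only [quintic, add_comm (var (a i))]

theorem quadric_le {i j : Fin t} {u : EdgeVar t →₀ ℕ} (hi : u (a i) ≠ 0) (hj : u (b j) ≠ 0) :
    quadric i j ≤ u := by
  intro e
  cases e <;> simp [quadric, Finsupp.single_apply]
  all_goals split_ifs <;> grind

theorem quintic_le {i j : Fin t} {u : EdgeVar t →₀ ℕ} (hi : u (a i) ≠ 0) (hj : u (a j) ≠ 0)
    (hij : i = j → 2 ≤ u (a i)) (h₁ : u f₁ ≠ 0) (h₃ : u f₃ ≠ 0) (h₂ : u e₂ ≠ 0) :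
    quintic i j ≤ u := by
  intro e
  cases e <;> simp [quintic, Finsupp.single_apply]
  case a k => split_ifs <;> grind
  all_goals omega

/-- A monomial that is not minimal among those with its vertex degrees is divisible by one of the
generators. -/
theorem exists_le_of_lt {u v : EdgeVar t →₀ ℕ} (h : vertexDegree t v = vertexDegree t u)
    (hlt : v ≺[degRevLex (EdgeVar t)] u) : ∃ s ∈ M₁ t ∪ M₂ t ∪ M₃ t, s ≤ u := by
  have hx₁ := DFunLike.congr_fun h .x₁
  have hx₂ := DFunLike.congr_fun h .x₂
  have hz₁ := DFunLike.congr_fun h .z₁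
  have hz₂ := DFunLike.congr_fun h .z₂
  have hw₁ := DFunLike.congr_fun h .w₁
  have hw₂ := DFunLike.congr_fun h .w₂
  have hy (i : Fin t) := DFunLike.congr_fun h (.y i)
  simp only [vertexDegree_x₁, vertexDegree_x₂, vertexDegree_y, vertexDegree_z₁, vertexDegree_z₂,
    vertexDegree_w₁, vertexDegree_w₂] at hx₁ hx₂ hz₁ hz₂ hw₁ hw₂ hy
  have hs := Finset.sum_congr (s₁ := Finset.univ) rfl fun i _ => hy i
  rw [Finset.sum_add_distrib, Finset.sum_add_distrib] at hs
  rcases lt_or_ge (v e₂) (u e₂) with he | he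
  -- Put `d = u e₂ - v e₂ > 0`. The degrees at the `z`'s and at `x₁` show that the `a`-sum of `u`
  -- exceeds that of `v` by `2 * d`. The `b`-sum then falls short by `2 * d`, and `x₂`, `w₁`, `w₂`
  -- give `u f₁ = v f₁ + d` and `u f₃ = v f₃ + d`.
  · have h2 : 2 ≤ ∑ i, u (a i) := by omega
    obtain ⟨i, -, hi⟩ := Finset.exists_ne_zero_of_sum_ne_zero (by omega : ∑ i, u (a i) ≠ 0)
    by_cases hj : ∃ j, j ≠ i ∧ u (a j) ≠ 0
    · obtain ⟨j, hji, hj⟩ := hj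
      refine ⟨quintic i j, Or.inl (Or.inr ?_), quintic_le hi hj (fun h => absurd h.symm hji)
        (by omega) (by omega) (by omega)⟩
      rcases lt_or_gt_of_ne hji with h | h
      · exact ⟨j, i, h, quintic_comm _ _⟩
      · exact ⟨i, j, h, rfl⟩
    · push Not at hj
      rw [Finset.sum_eq_single i (fun j _ hji => hj j hji) (by simp)] at h2
      exact ⟨quintic i i, Or.inr ⟨i, rfl⟩, quintic_le hi hi (fun _ => h2)
        (by omega) (by omega) (by omega)⟩
  · rw [degRevLex_lt_iff, degree_eq, degree_eq] at hlt
    obtain hlt | ⟨-, k, hk, hlt⟩ := hlt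
    · omega
    by_cases hb : ∃ i, k = b i
    · obtain ⟨i, rfl⟩ := hb
      -- As `u e₂ ≤ v e₂`, the `b`-sum of `v` is at most that of `u`, so the excess of `v` at `b i`
      -- is compensated at some `b j`. By the choice of `b i` as last difference, `j < i`; the
      -- degree at `y i` then makes `a i` divide `u`.
      obtain ⟨j, hj⟩ : ∃ j, v (b j) < u (b j) := by
        by_contra! H
        have := Finset.sum_lt_sum (s := Finset.univ) (fun i _ => H i) ⟨i, Finset.mem_univ i, hlt⟩
        omega
      have hji : j < i := by
        rcases lt_trichotomy j i with h | rfl | h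
        · exact h
        · omega
        · have := hk (b j) (Nat.add_lt_add_left h _)
          omega
      have := hy i
      exact ⟨quadric i j, Or.inl (Or.inl ⟨i, j, hji, rfl⟩), quadric_le (by omega) (by omega)⟩
    -- If the last difference precedes all `b`'s, the `b`'s agree, hence the `a`'s by the degrees at
    -- the `y`'s. The triangle exponents are then determined, because triangles are odd cycles, and
    -- `u` and `v` do not differ at all.
    · have hB (i : Fin t) : v (b i) = u (b i) := by
        refine hk _ ?_
        change k.pos < t + 6 + i
        cases k <;> simp [pos] at hb ⊢ <;> omega
      have hA (i : Fin t) : v (a i) = u (a i) := by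
        have := hy i
        have := hB i
        omega
      have hB' : ∑ i, v (b i) = ∑ i, u (b i) := Finset.sum_congr rfl fun i _ => hB i
      have hA' : ∑ i, v (a i) = ∑ i, u (a i) := Finset.sum_congr rfl fun i _ => hA i
      cases k with
      | a i => have := hA i; omega
      | b i => exact absurd ⟨i, rfl⟩ hb
      | _ => omega

/-- The binomial with terms `u` and `v` lies in the toric ideal and has leading term `u`. -/
theorem monomial_mem_initialIdeal (K : Type*) [Field K] {u v : EdgeVar t →₀ ℕ}
    (h : vertexDegree t v = vertexDegree t u) (hlt : v ≺[degRevLex (EdgeVar t)] u) :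
    monomial u (1 : K) ∈ initialIdeal (degRevLex (EdgeVar t)) (toricIdeal K t) := by
  classical
  refine Ideal.subset_span ⟨_, monomial_sub_monomial_mem_toricIdeal K h.symm, ?_⟩
  have hlt' : (degRevLex (EdgeVar t)).toSyn
      ((degRevLex (EdgeVar t)).degree (monomial v (1 : K))) <
      (degRevLex (EdgeVar t)).toSyn ((degRevLex (EdgeVar t)).degree (monomial u (1 : K))) := by
    simpa [MonomialOrder.degree_monomial] using hlt
  rw [MonomialOrder.leadingTerm, MonomialOrder.degree_sub_of_lt hlt',
    MonomialOrder.leadingCoeff_sub_of_lt hlt', MonomialOrder.leadingCoeff_monomial,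
    MonomialOrder.degree_monomial, if_neg one_ne_zero]

theorem vertexDegree_ext {u v : EdgeVar t →₀ ℕ}
    (hy : ∀ i, u (a i) + u (b i) = v (a i) + v (b i))
    (hx₁ : ∑ i, u (a i) + u e₁ + u e₃ = ∑ i, v (a i) + v e₁ + v e₃)
    (hx₂ : ∑ i, u (b i) + u f₁ + u f₃ = ∑ i, v (b i) + v f₁ + v f₃)
    (hz₁ : u e₁ + u e₂ = v e₁ + v e₂) (hz₂ : u e₂ + u e₃ = v e₂ + v e₃)
    (hw₁ : u f₁ + u f₂ = v f₁ + v f₂) (hw₂ : u f₂ + u f₃ = v f₂ + v f₃) :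
    vertexDegree t u = vertexDegree t v := by
  ext w
  cases w <;> simp only [vertexDegree_x₁, vertexDegree_x₂, vertexDegree_y, vertexDegree_z₁,
    vertexDegree_z₂, vertexDegree_w₁, vertexDegree_w₂, *]

theorem quadric_swap_lt {i j : Fin t} (h : j < i) :
    quadric j i ≺[degRevLex (EdgeVar t)] quadric i j := by
  rw [degRevLex_lt_iff]
  refine Or.inr ⟨by simp [quadric], b i, fun e he => ?_, ?_⟩
  · change pos (b i) < e.pos at he
    cases e <;> simp [quadric, pos, Finsupp.single_apply] at he ⊢ <;> grind
  · simp [quadric, h.ne]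

/-- The two monomials are the alternate edges of the closed walk from `x₁` around its triangle, over
`y j` to `x₂`, around that triangle and back over `y i`. They last differ at `b i`, which is why `j
≤ i` is needed. -/
theorem quintic_conj_lt {i j : Fin t} (h : j ≤ i) :
    var (b i) + var (b j) + var e₁ + var e₃ + var f₂ ≺[degRevLex (EdgeVar t)] quintic i j := by
  rw [degRevLex_lt_iff]
  refine Or.inr ⟨by simp [quintic], b i, fun e he => ?_, ?_⟩
  · change pos (b i) < e.pos at he
    cases e <;> simp [quintic, pos, Finsupp.single_apply] at he ⊢ <;> grind
  · simp [quintic, Finsupp.single_apply]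

theorem initialIdeal_eq (K : Type*) [Field K] :
    monomialIdeal K (M₁ t ∪ M₂ t ∪ M₃ t) =
      initialIdeal (degRevLex (EdgeVar t)) (toricIdeal K t) := by
  apply le_antisymm
  · have hq (i j : Fin t) (h : j ≤ i) : monomial (quintic i j) (1 : K) ∈
        initialIdeal (degRevLex (EdgeVar t)) (toricIdeal K t) := by
      refine monomial_mem_initialIdeal K ?_ (quintic_conj_lt h)
      apply vertexDegree_ext <;>
        simp [quintic, Finsupp.single_apply, Finset.sum_add_distrib]
    rw [monomialIdeal, Ideal.span_le]
    rintro _ ⟨_, (⟨i, j, h, rfl⟩ | ⟨i, j, h, rfl⟩) | ⟨i, rfl⟩, rfl⟩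
    · refine monomial_mem_initialIdeal K ?_ (quadric_swap_lt h)
      apply vertexDegree_ext <;>
        simp [quadric, Finsupp.single_apply, add_comm]
    · simp only [quintic_comm i j]
      exact hq j i h.le
    · exact hq i i le_rfl
  · rw [initialIdeal, Ideal.span_le]
    rintro _ ⟨h, hh, rfl⟩
    rcases eq_or_ne h 0 with rfl | h0
    · simp
    have hu := (degRevLex (EdgeVar t)).degree_mem_support h0
    obtain ⟨v, hv, hne, hvu⟩ := exists_mem_support_of_mem_toricIdeal hh hu
    have hlt := lt_of_le_of_ne ((degRevLex (EdgeVar t)).le_degree hv)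
      (fun h => hne ((degRevLex (EdgeVar t)).toSyn.injective h))
    obtain ⟨s, hs, hsu⟩ := exists_le_of_lt hvu hlt
    refine mem_monomialIdeal_iff.2 fun w hw => ⟨s, hs, ?_⟩
    rwa [Finset.mem_singleton.1 (support_monomial_subset hw)]

/-! ### The order of the generators -/

theorem quadric_lt_quadric {i j k l : Fin t} (hkl : l < k)
    (h : j < l ∨ j = l ∧ i < k) : quadric k l ≺[degRevLex (EdgeVar t)] quadric i j := by
  rw [degRevLex_lt_iff]
  refine Or.inr ⟨by simp [quadric], ?_⟩
  rcases h with h | ⟨rfl, h⟩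
  · refine ⟨b l, fun e he => ?_, by simp [quadric, Finsupp.single_apply]; omega⟩
    change pos (b l) < e.pos at he
    cases e <;> simp [quadric, pos, Finsupp.single_apply] at he ⊢ <;> grind
  · refine ⟨a k, fun e he => ?_, by simp [quadric, Finsupp.single_apply]; omega⟩
    change pos (a k) < e.pos at he
    cases e <;> simp [quadric, pos, Finsupp.single_apply] at he ⊢ <;> grind

theorem quintic_lt_quintic {i j k l : Fin t} (hij : j ≤ i) (hkl : l ≤ k)
    (h : i < k ∨ i = k ∧ j < l) : quintic k l ≺[degRevLex (EdgeVar t)] quintic i j := by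
  rw [degRevLex_lt_iff]
  refine Or.inr ⟨by simp [quintic], ?_⟩
  rcases h with h | ⟨rfl, h⟩
  · refine ⟨a k, fun e he => ?_, by simp [quintic, Finsupp.single_apply]; grind⟩
    change pos (a k) < e.pos at he
    cases e <;> simp [quintic, pos, Finsupp.single_apply] at he ⊢ <;> grind
  · refine ⟨a l, fun e he => ?_, by simp [quintic, Finsupp.single_apply]; grind⟩
    change pos (a l) < e.pos at he
    cases e <;> simp [quintic, pos, Finsupp.single_apply] at he ⊢ <;> grind

theorem pairwise_descending (t : ℕ) : (descending t).Pairwise (· > ·) :=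
  List.pairwise_reverse.2 (List.pairwise_lt_finRange t)

theorem mem_descending (i : Fin t) : i ∈ descending t := by
  simp [descending]

theorem mem_L₁_iff {u : EdgeVar t →₀ ℕ} : u ∈ L₁ t ↔ ∃ i j : Fin t, j < i ∧ u = quadric i j := by
  simp only [L₁, List.mem_flatMap, mem_descending, true_and, List.mem_map, List.mem_filter,
    decide_eq_true_eq]
  grind

theorem mem_L₂_iff {u : EdgeVar t →₀ ℕ} : u ∈ L₂ t ↔ ∃ i j : Fin t, j < i ∧ u = quintic i j := by
  simp only [L₂, List.mem_flatMap, mem_descending, true_and, List.mem_map, List.mem_filter,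
    decide_eq_true_eq]
  grind

theorem mem_L₃_iff {u : EdgeVar t →₀ ℕ} : u ∈ L₃ t ↔ ∃ i : Fin t, u = quintic i i := by
  simp only [L₃, mem_descending, true_and, List.mem_map, eq_comm]

theorem isIncreasingEnumeration_L₁ : IsIncreasingEnumeration (L₁ t) (M₁ t) := by
  refine ⟨Set.ext fun u => mem_L₁_iff, ?_⟩
  rw [L₁, List.pairwise_flatMap]
  constructor
  · intro j _
    rw [List.pairwise_map, List.pairwise_filter]
    refine (pairwise_descending t).imp fun {k i} hki hk hi => ?_
    exact quadric_lt_quadric (of_decide_eq_true hk) (Or.inr ⟨rfl, hki⟩)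
  · refine (pairwise_descending t).imp fun {l j} hlj u hu v hv => ?_
    simp only [List.mem_map, List.mem_filter, decide_eq_true_eq] at hu hv
    obtain ⟨k, hk, rfl⟩ := hu
    obtain ⟨i, hi, rfl⟩ := hv
    exact quadric_lt_quadric hk.2 (Or.inl hlj)

theorem isIncreasingEnumeration_L₂ : IsIncreasingEnumeration (L₂ t) (M₂ t) := by
  constructor
  · ext u
    rw [Set.mem_ofPred_eq, mem_L₂_iff, exists_comm]
    simp only [M₂, quintic_comm, Set.mem_ofPred_eq]
  rw [L₂, List.pairwise_flatMap]
  constructor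
  · intro i _
    rw [List.pairwise_map, List.pairwise_filter]
    refine (pairwise_descending t).imp fun {l j} hlj hl hj => ?_
    exact quintic_lt_quintic (of_decide_eq_true hj : j < i).le (of_decide_eq_true hl : l < i).le
      (Or.inr ⟨rfl, hlj⟩)
  · refine (pairwise_descending t).imp fun {k i} hki u hu v hv => ?_
    simp only [List.mem_map, List.mem_filter, decide_eq_true_eq] at hu hv
    obtain ⟨l, hl, rfl⟩ := hu
    obtain ⟨j, hj, rfl⟩ := hv
    exact quintic_lt_quintic hj.2.le hl.2.le (Or.inl hki)

theorem isIncreasingEnumeration_L₃ : IsIncreasingEnumeration (L₃ t) (M₃ t) := by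
  refine ⟨Set.ext fun u => mem_L₃_iff, ?_⟩
  rw [L₃, List.pairwise_map]
  exact (pairwise_descending t).imp fun {k i} hki =>
    quintic_lt_quintic le_rfl le_rfl (Or.inl hki)

/-! ### Length of the list and relative position of its entries -/

theorem sum_map_descending (F : Fin t → ℕ) : ((descending t).map F).sum = ∑ i, F i := by
  rw [descending, List.map_reverse, List.sum_reverse, ← List.ofFn_eq_map, List.sum_ofFn]

theorem length_filter_descending (P : Fin t → Prop) [DecidablePred P] :
    ((descending t).filter (fun i => P i)).length = (Finset.univ.filter P).card := by
  have hnd : (descending t).Nodup := (pairwise_descending t).imp ne_of_gt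
  rw [← List.toFinset_card_of_nodup (hnd.filter _)]
  congr 1
  ext i
  simp [mem_descending]

theorem length_generators (t : ℕ) : (generators t).length = t ^ 2 := by
  simp only [generators, L₁, L₂, L₃, List.length_append, List.length_flatMap, List.length_map,
    length_filter_descending, sum_map_descending]
  -- The index `i` contributes the indices above it to `L₁` and those below it to `L₂`, hence `t -
  -- 1` in total; `L₃` adds one more.
  have h (i : Fin t) : (Finset.univ.filter (i < ·)).card + (Finset.univ.filter (· < i)).card =
      t - 1 := by
    rw [Finset.filter_lt_eq_Ioi, Finset.filter_gt_eq_Iio, Fin.card_Ioi, Fin.card_Iio]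
    omega
  rw [← Finset.sum_add_distrib, Finset.sum_congr rfl fun i _ => h i]
  rcases t with _ | t
  · rfl
  · simp [descending]; ring

theorem mem_generators_iff {u : EdgeVar t →₀ ℕ} : u ∈ generators t ↔
    (∃ i j : Fin t, j < i ∧ u = quadric i j) ∨ ∃ i j : Fin t, j ≤ i ∧ u = quintic i j := by
  rw [generators, List.mem_append, List.mem_append, mem_L₁_iff, mem_L₂_iff, mem_L₃_iff, or_assoc]
  refine or_congr Iff.rfl ?_
  constructor
  · rintro (⟨i, j, h, rfl⟩ | ⟨i, rfl⟩)
    exacts [⟨i, j, h.le, rfl⟩, ⟨i, i, le_rfl, rfl⟩]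
  · rintro ⟨i, j, h, rfl⟩
    rcases h.lt_or_eq with h | rfl
    exacts [Or.inl ⟨i, j, h, rfl⟩, Or.inr ⟨j, rfl⟩]

open Classical in
/-- The number of the block, from zero, to which a generator belongs. -/
noncomputable def block (u : EdgeVar t →₀ ℕ) : ℕ := u f₁ + if ∃ i, 2 ≤ u (a i) then 1 else 0

theorem block_quadric (i j : Fin t) : block (quadric i j) = 0 := by
  have : ¬ ∃ k, 2 ≤ quadric i j (a k) := by
    rintro ⟨k, hk⟩
    simp only [quadric, Finsupp.add_apply, Finsupp.single_apply] at hk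
    grind
  rw [block, if_neg this]
  simp [quadric]

theorem block_quintic_of_ne {i j : Fin t} (h : i ≠ j) : block (quintic i j) = 1 := by
  have : ¬ ∃ k, 2 ≤ quintic i j (a k) := by
    rintro ⟨k, hk⟩
    simp only [quintic, Finsupp.add_apply, Finsupp.single_apply] at hk
    grind
  rw [block, if_neg this]
  simp [quintic]

theorem block_quintic_self (i : Fin t) : block (quintic i i) = 2 := by
  have : ∃ k, 2 ≤ quintic i i (a k) := ⟨i, by simp [quintic]⟩
  rw [block, if_pos this]
  simp [quintic]

/-- The order of the generators in their list: by blocks, then by the monomial order. -/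
def Before (u v : EdgeVar t →₀ ℕ) : Prop :=
  block u < block v ∨ block u = block v ∧ u ≺[degRevLex (EdgeVar t)] v

theorem Before.asymm {u v : EdgeVar t →₀ ℕ} (h : Before u v) : ¬ Before v u := by
  rintro (h' | ⟨h₁', h₂'⟩) <;> rcases h with h | ⟨h₁, h₂⟩
  · omega
  · omega
  · omega
  · exact lt_asymm h₂ h₂'

theorem pairwise_generators (t : ℕ) : (generators t).Pairwise Before := by
  have block₁ {u : EdgeVar t →₀ ℕ} (hu : u ∈ L₁ t) : block u = 0 := by
    obtain ⟨i, j, -, rfl⟩ := mem_L₁_iff.1 hu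
    exact block_quadric i j
  have block₂ {u : EdgeVar t →₀ ℕ} (hu : u ∈ L₂ t) : block u = 1 := by
    obtain ⟨i, j, h, rfl⟩ := mem_L₂_iff.1 hu
    exact block_quintic_of_ne h.ne'
  have block₃ {u : EdgeVar t →₀ ℕ} (hu : u ∈ L₃ t) : block u = 2 := by
    obtain ⟨i, rfl⟩ := mem_L₃_iff.1 hu
    exact block_quintic_self i
  rw [generators, List.pairwise_append, List.pairwise_append]
  refine ⟨⟨?_, ?_, ?_⟩, ?_, ?_⟩
  · exact isIncreasingEnumeration_L₁.2.imp_of_mem fun hu hv h =>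
      Or.inr ⟨(block₁ hu).trans (block₁ hv).symm, h⟩
  · exact isIncreasingEnumeration_L₂.2.imp_of_mem fun hu hv h =>
      Or.inr ⟨(block₂ hu).trans (block₂ hv).symm, h⟩
  · intro u hu v hv
    exact Or.inl (by rw [block₁ hu, block₂ hv]; omega)
  · exact isIncreasingEnumeration_L₃.2.imp_of_mem fun hu hv h =>
      Or.inr ⟨(block₃ hu).trans (block₃ hv).symm, h⟩
  · intro u hu v hv
    refine Or.inl ?_
    rw [block₃ hv]
    rcases List.mem_append.1 hu with hu | hu
    · rw [block₁ hu]; omega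
    · rw [block₂ hu]; omega

theorem mem_take_generators_iff {p : Fin (generators t).length} {u : EdgeVar t →₀ ℕ} :
    u ∈ (generators t).take p ↔ u ∈ generators t ∧ Before u ((generators t).get p) :=
  List.mem_take_iff_of_pairwise (fun _ _ => Before.asymm) (pairwise_generators t) p

theorem before_quadric_quadric {i j k l : Fin t} (hij : j < i) (hkl : l < k) :
    Before (quadric k l) (quadric i j) ↔ j < l ∨ j = l ∧ i < k := by
  have key {i j k l : Fin t} (hij : j < i) (hkl : l < k) (h : j < l ∨ j = l ∧ i < k) :
      Before (quadric k l) (quadric i j) :=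
    Or.inr ⟨by simp only [block_quadric], quadric_lt_quadric hkl h⟩
  refine ⟨fun h => ?_, key hij hkl⟩
  by_contra H
  by_cases h' : l < j ∨ l = j ∧ k < i
  · exact h.asymm (key hkl hij h')
  · obtain ⟨rfl, rfl⟩ : j = l ∧ i = k := by omega
    exact h.asymm h

theorem before_quadric_quintic (i j k l : Fin t) : Before (quadric k l) (quintic i j) := by
  refine Or.inl ?_
  rw [block_quadric]
  rcases eq_or_ne i j with rfl | h
  · rw [block_quintic_self]; omega
  · rw [block_quintic_of_ne h]; omega

/-- The first alternative puts a squarefree quintic before a square one, whatever the monomial order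
says; the second compares within one block. -/
theorem before_quintic_quintic {i j k l : Fin t} (hij : j ≤ i) (hkl : l ≤ k) :
    Before (quintic k l) (quintic i j) ↔
      (l < k ∧ j = i) ∨ ((l = k ↔ j = i) ∧ (i < k ∨ i = k ∧ j < l)) := by
  have key {i j k l : Fin t} (hij : j ≤ i) (hkl : l ≤ k)
      (h : (l < k ∧ j = i) ∨ ((l = k ↔ j = i) ∧ (i < k ∨ i = k ∧ j < l))) :
      Before (quintic k l) (quintic i j) := by
    rcases h with ⟨h, rfl⟩ | ⟨h, h'⟩
    · exact Or.inl (by rw [block_quintic_self, block_quintic_of_ne h.ne']; omega)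
    · refine Or.inr ⟨?_, quintic_lt_quintic hij hkl h'⟩
      by_cases hh : j = i
      · obtain rfl := hh
        obtain rfl := h.2 rfl
        rw [block_quintic_self, block_quintic_self]
      · rw [block_quintic_of_ne (Ne.symm hh), block_quintic_of_ne (Ne.symm (mt h.1 hh))]
  refine ⟨fun h => ?_, key hij hkl⟩
  by_contra H
  by_cases h' : (j < i ∧ l = k) ∨ ((j = i ↔ l = k) ∧ (k < i ∨ k = i ∧ l < j))
  · exact h.asymm (key hkl hij h')
  · obtain ⟨rfl, rfl⟩ : j = l ∧ i = k := by omega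
    exact h.asymm h

theorem not_before_quintic_quadric (i j k l : Fin t) : ¬ Before (quintic k l) (quadric i j) :=
  (before_quadric_quintic k l i j).asymm

/-! ### Minimality -/

theorem eq_of_le_of_mem_generators {u v : EdgeVar t →₀ ℕ} (hu : u ∈ generators t)
    (hv : v ∈ generators t) (h : u ≤ v) : u = v := by
  rcases mem_generators_iff.1 hu with ⟨i, j, hij, rfl⟩ | ⟨i, j, hij, rfl⟩ <;>
    rcases mem_generators_iff.1 hv with ⟨k, l, hkl, rfl⟩ | ⟨k, l, hkl, rfl⟩
  · have h₁ := h (a i)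
    have h₂ := h (b j)
    simp [quadric, Finsupp.single_apply, Nat.one_le_iff_ne_zero] at h₁ h₂
    rw [h₁, h₂]
  · have := h (b j)
    simp [quadric, quintic] at this
  · have := h f₁
    simp [quadric, quintic] at this
  · have h₁ := h (a i)
    have h₂ := h (a j)
    simp only [quintic, Finsupp.add_apply, Finsupp.single_apply, EdgeVar.a.injEq, reduceCtorEq,
      if_false] at h₁ h₂
    obtain ⟨rfl, rfl⟩ : i = k ∧ j = l := by grind
    rfl

theorem setOf_mem_generators : {u | u ∈ generators t} = M₁ t ∪ M₂ t ∪ M₃ t := by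
  rw [← isIncreasingEnumeration_L₁.1, ← isIncreasingEnumeration_L₂.1,
    ← isIncreasingEnumeration_L₃.1]
  ext u
  simp only [generators, List.mem_append, Set.mem_union, Set.mem_ofPred_eq]

theorem isMinimalMonomialGenerators (K : Type*) [Field K] :
    IsMinimalMonomialGenerators
      (initialIdeal (degRevLex (EdgeVar t)) (toricIdeal K t)) (generators t) := by
  refine ⟨by rw [setOf_mem_generators, initialIdeal_eq], fun p hp => ?_⟩
  obtain ⟨_, ⟨q, hqp, rfl⟩, hle⟩ := monomial_mem_monomialIdeal_iff.1 hp
  have heq := eq_of_le_of_mem_generators (List.get_mem _ q) (List.get_mem _ p) hle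
  have hpw := List.pairwise_iff_get.1 (pairwise_generators t)
  -- A repeated entry would come before itself.
  rcases lt_or_gt_of_ne hqp with h | h
  · have := hpw _ _ h
    rw [heq] at this
    exact this.asymm this
  · have := hpw _ _ h
    rw [heq] at this
    exact this.asymm this

/-! ### The colon ideals -/

theorem quintic_le_var_add_right {i j k : Fin t} : quintic i k ≤ var (a k) + quintic i j := by
  intro e
  simp only [quintic, Finsupp.add_apply]
  omega

theorem quintic_le_var_add_left {i j k : Fin t} : quintic k i ≤ var (a k) + quintic i j := by
  intro e
  simp only [quintic, Finsupp.add_apply]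
  omega

theorem exists_variable {u v : EdgeVar t →₀ ℕ} (hv : v ∈ generators t) (hu : u ∈ generators t)
    (h : Before u v) :
    ∃ e, (∃ s, (s ∈ generators t ∧ Before s v) ∧ s ≤ var e + v) ∧ v e < u e := by
  have hQ {i j : Fin t} (h : j < i) : quadric i j ∈ generators t :=
    mem_generators_iff.2 (Or.inl ⟨i, j, h, rfl⟩)
  have hR {i j : Fin t} (h : j ≤ i) : quintic i j ∈ generators t :=
    mem_generators_iff.2 (Or.inr ⟨i, j, h, rfl⟩)
  rcases mem_generators_iff.1 hv with ⟨i, j, hij, rfl⟩ | ⟨i, j, hij, rfl⟩ <;>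
    rcases mem_generators_iff.1 hu with ⟨k, l, hkl, rfl⟩ | ⟨k, l, hkl, rfl⟩
  · rw [before_quadric_quadric hij hkl] at h
    rcases lt_or_ge i k with hik | hki
    · refine ⟨a k, ⟨quadric k j, ⟨hQ (hij.trans hik), ?_⟩, ?_⟩, ?_⟩
      · exact (before_quadric_quadric hij (hij.trans hik)).2 (Or.inr ⟨rfl, hik⟩)
      · apply quadric_le <;> simp [quadric]
      · simp [quadric, hik.ne]
    · have hjl : j < l := by omega
      have hli : l < i := by omega
      refine ⟨b l, ⟨quadric i l, ⟨hQ hli, ?_⟩, ?_⟩, ?_⟩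
      · exact (before_quadric_quadric hij hli).2 (Or.inl hjl)
      · apply quadric_le <;> simp [quadric]
      · simp [quadric, hjl.ne]
  · exact absurd h (not_before_quintic_quadric i j k l)
  · rcases lt_or_ge l i with hli | hil
    · refine ⟨b l, ⟨quadric i l, ⟨hQ hli, before_quadric_quintic i j i l⟩, ?_⟩, ?_⟩
      · apply quadric_le <;> simp [quintic]
      · simp [quadric, quintic]
    · have hik : i < k := by omega
      refine ⟨a k, ⟨quintic k i, ⟨hR hik.le, ?_⟩, quintic_le_var_add_left⟩, ?_⟩
      · rw [before_quintic_quintic hij hik.le]; omega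
      · simp [quadric, quintic, Finsupp.single_apply]; omega
  · rw [before_quintic_quintic hij hkl] at h
    rcases lt_or_ge i k with hik | hki
    · refine ⟨a k, ⟨quintic k i, ⟨hR hik.le, ?_⟩, quintic_le_var_add_left⟩, ?_⟩
      · rw [before_quintic_quintic hij hik.le]; omega
      · simp [quintic, Finsupp.single_apply]; grind
    · have hli : l < i := by omega
      by_cases hlj : j = l
      -- Here `k ≤ i`, so `h` requires either `j = i` with `l < i`, or `k = i` with `j < l`; both
      -- exclude `j = l`.
      · refine absurd h ?_
        omega
      · refine ⟨a l, ⟨quintic i l, ⟨hR hli.le, ?_⟩, ?_⟩, ?_⟩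
        · rw [before_quintic_quintic hij hli.le]; omega
        · exact quintic_le_var_add_right
        · simp [quintic, Finsupp.single_apply]; grind

/-! ### The number of variables in a colon ideal -/

/-- The variables in the colon ideal at the generator `v`. -/
def colonVars (v : EdgeVar t →₀ ℕ) : Set (EdgeVar t) :=
  {e | ∃ s, (s ∈ generators t ∧ Before s v) ∧ s ≤ var e + v}

theorem numColonVars_generators (K : Type*) [Field K] (p : Fin (generators t).length) :
    numColonVars K (generators t) p = (colonVars ((generators t).get p)).ncard := by
  simp only [numColonVars, X_mem_colonAt_iff, mem_take_generators_iff, colonVars]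

/-- All `a k` with `k ≠ i`, and all `b l` except the last one. -/
def boundVars (i : Fin t) : Set (EdgeVar t) := a '' {i}ᶜ ∪ b '' {l | (l : ℕ) + 1 < t}

theorem ncard_boundVars (i : Fin t) : (boundVars i).ncard = 2 * t - 2 := by
  have h : {l : Fin t | (l : ℕ) + 1 < t} = {⟨t - 1, by have := i.2; omega⟩}ᶜ := by
    ext l
    have := l.2
    simp [Fin.ext_iff]
    omega
  have ha : Function.Injective (a (t := t)) := fun i j h => by simpa using h
  have hb : Function.Injective (b (t := t)) := fun i j h => by simpa using h
  rw [boundVars, Set.ncard_union_eq, Set.ncard_image_of_injective _ ha,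
    Set.ncard_image_of_injective _ hb, h, Set.ncard_compl, Set.ncard_compl]
  · simp; omega
  · rw [Set.disjoint_left]
    rintro _ ⟨k, -, rfl⟩ ⟨l, -, h⟩
    simp at h

theorem colonVars_subset {v : EdgeVar t →₀ ℕ} (hv : v ∈ generators t) :
    ∃ i, colonVars v ⊆ boundVars i := by
  -- Otherwise `s` would already divide `v`, against minimality of the generators.
  have hlt {s : EdgeVar t →₀ ℕ} {e : EdgeVar t} (hs : s ∈ generators t) (hb : Before s v)
      (hle : s ≤ var e + v) : v e < s e := by
    by_contra! H
    have : s = v := by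
      refine eq_of_le_of_mem_generators hs hv fun e' => ?_
      rcases eq_or_ne e e' with rfl | h
      · exact H
      · simpa [Finsupp.single_apply, h] using hle e'
    subst this
    exact hb.asymm hb
  rcases mem_generators_iff.1 hv with ⟨i, j, hij, rfl⟩ | ⟨i, j, hij, rfl⟩
  · refine ⟨i, ?_⟩
    rintro e ⟨s, ⟨hs, hb⟩, hle⟩
    have := hlt hs hb hle
    rcases mem_generators_iff.1 hs with ⟨k, l, hkl, rfl⟩ | ⟨k, l, hkl, rfl⟩
    · cases e <;> simp [quadric, Finsupp.single_apply, boundVars] at this ⊢ <;> grind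
    · exact absurd hb (not_before_quintic_quadric i j k l)
  · refine ⟨i, ?_⟩
    rintro e ⟨s, ⟨hs, hb⟩, hle⟩
    have := hlt hs hb hle
    rcases mem_generators_iff.1 hs with ⟨k, l, hkl, rfl⟩ | ⟨k, l, hkl, rfl⟩
    · cases e <;> simp [quadric, quintic, Finsupp.single_apply, boundVars] at this ⊢ <;> grind
    -- The variable `a i` could only come from the square quintic at `i` with `v` not a square, and
    -- squares are listed later.
    · rw [before_quintic_quintic hij hkl] at hb
      cases e <;> simp [quintic, Finsupp.single_apply, boundVars] at this ⊢
      grind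

theorem boundVars_subset_colonVars {i : Fin t} (hi : (i : ℕ) + 1 = t) :
    boundVars i ⊆ colonVars (quintic i i) := by
  rintro _ (⟨k, hk, rfl⟩ | ⟨l, hl, rfl⟩)
  · rw [Set.mem_compl_iff, Set.mem_singleton_iff] at hk
    have hki : k < i := by omega
    exact ⟨quintic i k, ⟨mem_generators_iff.2 (Or.inr ⟨i, k, hki.le, rfl⟩),
      (before_quintic_quintic le_rfl hki.le).2 (Or.inl ⟨hki, rfl⟩)⟩, quintic_le_var_add_right⟩
  · rw [Set.mem_ofPred_eq] at hl
    have hli : l < i := by omega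
    refine ⟨quadric i l, ⟨mem_generators_iff.2 (Or.inl ⟨i, l, hli, rfl⟩),
      before_quadric_quintic i i i l⟩, ?_⟩
    apply quadric_le <;> simp [quintic]

theorem hasLinearQuotientsWith (K : Type*) [Field K] :
    HasLinearQuotientsWith (initialIdeal (degRevLex (EdgeVar t)) (toricIdeal K t))
      (generators t) := by
  refine ⟨isMinimalMonomialGenerators K, fun p _ => ⟨_, colonAt_eq_span_X fun u hu => ?_⟩⟩
  simp only [mem_take_generators_iff] at hu ⊢
  exact exists_variable (List.get_mem _ p) hu.1 hu.2

theorem isGreatest_numColonVars (K : Type*) [Field K] (ht : 2 ≤ t) :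
    IsGreatest {n : ℕ | ∃ p : Fin (generators t).length,
      1 ≤ (p : ℕ) ∧ n = numColonVars K (generators t) p} (2 * t - 2) := by
  have hle (p : Fin (generators t).length) : numColonVars K (generators t) p ≤ 2 * t - 2 := by
    obtain ⟨i, hi⟩ := colonVars_subset (List.get_mem _ p)
    rw [numColonVars_generators, ← ncard_boundVars i]
    exact Set.ncard_le_ncard hi (Set.toFinite _)
  constructor
  · obtain ⟨i, hi⟩ : ∃ i : Fin t, (i : ℕ) + 1 = t := ⟨⟨t - 1, by omega⟩, by simp only; omega⟩
    obtain ⟨p, hp⟩ := List.get_of_mem (mem_generators_iff.2 (Or.inr ⟨i, i, le_rfl, rfl⟩))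
    refine ⟨p, ?_, (hle p).antisymm' ?_⟩
    -- The position is not the first one: `a₂ b₁`, which exists because `2 ≤ t`, is listed before
    -- every quintic.
    · have h : quadric (⟨1, by omega⟩ : Fin t) ⟨0, by omega⟩ ∈ (generators t).take p := by
        rw [mem_take_generators_iff, hp]
        exact ⟨mem_generators_iff.2 (Or.inl ⟨_, _, Nat.one_pos, rfl⟩),
          before_quadric_quintic _ _ _ _⟩
      by_contra! h0
      rw [Nat.lt_one_iff.1 h0] at h
      simp at h
    · rw [numColonVars_generators, hp, ← ncard_boundVars i]
      exact Set.ncard_le_ncard (boundVars_subset_colonVars hi) (Set.toFinite _)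
  · rintro _ ⟨p, -, rfl⟩
    exact hle p

end TriangleGraph

theorem mainTheorem5 (K : Type*) [Field K] [IsAlgClosed K] [CharZero K] (t : ℕ) (ht : 2 ≤ t) :
    -- the three blocks of generators, each ordered increasingly
    TriangleGraph.IsIncreasingEnumeration (TriangleGraph.L₁ t) (TriangleGraph.M₁ t) ∧
    TriangleGraph.IsIncreasingEnumeration (TriangleGraph.L₂ t) (TriangleGraph.M₂ t) ∧
    TriangleGraph.IsIncreasingEnumeration (TriangleGraph.L₃ t) (TriangleGraph.M₃ t) ∧
    (TriangleGraph.generators t).length = t ^ 2 ∧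
    -- the generators, in this order, give linear quotients for the initial ideal
    HasLinearQuotientsWith
      (initialIdeal (degRevLex (TriangleGraph.EdgeVar t)) (TriangleGraph.toricIdeal K t))
      (TriangleGraph.generators t) ∧
    -- the maximal number of variables of the successive colon ideals
    IsGreatest
      {n : ℕ | ∃ p : Fin (TriangleGraph.generators t).length,
        1 ≤ (p : ℕ) ∧ n = numColonVars K (TriangleGraph.generators t) p}
      (2 * t - 2) :=
  ⟨TriangleGraph.isIncreasingEnumeration_L₁, TriangleGraph.isIncreasingEnumeration_L₂,
    TriangleGraph.isIncreasingEnumeration_L₃, TriangleGraph.length_generators t,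
    TriangleGraph.hasLinearQuotientsWith K, TriangleGraph.isGreatest_numColonVars K ht⟩
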